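/- All spaces are Hausdorff. A subset $S$ of a space $X$ is a nontrivial convergent sequence in $X$ if $S$ is countably infinite and there is a point $x\in S$ such that $S\setminus U$ is finite for every open $U\subseteq X$ with $x\in U$. Let $\mathcal S_c(X)$ be the set of all nontrivial convergent sequences in $X$ (each of which is a nonempty compact, hence closed, subset of $X$), endowed with the Vietoris topology, that is, the topology with base consisting of the sets $$\Big\{S\in\mathcal S_c(X) : S\subseteq \bigcup\mathcal U \text{ and } S\cap U\neq\emptyset \text{ for every } U\in\mathcal U\Big\},$$ where $\mathcal U$ runs over all finite families of open subsets of $X$. A space is locally pathwise connected if each of its points has a neighborhood basis consisting of pathwise connected (not necessarily open) neighborhoods. Let $X$ be a first countable Hausdorff space with $\mathcal S_c(X)\neq\emptyset$. Then the following conditions are equivalent: (i) $X$ is pathwise connected and locally pathwise connected; (ii) $\mathcal S_c(X)$ is pathwise connected and locally pathwise connected. -/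

import Mathlib

open TopologicalSpace

/-- A subset `S` of `X` is a nontrivial convergent sequence if it is countably infinite and there is
a point `x ∈ S` such that every open set containing `x` contains all but finitely many points
of `S`. -/
def IsNontrivialConvergentSequence {X : Type*} [TopologicalSpace X] (S : Set X) : Prop :=
  S.Countable ∧ S.Infinite ∧ ∃ x ∈ S, ∀ U : Set X, IsOpen U → x ∈ U → (S \ U).Finite

/-- The hyperspace of all nontrivial convergent sequences in `X`, as a subset of the hyperspace
`NonemptyCompacts X` of nonempty compact subsets of `X`, which carries the Vietoris topology.
Its coercion to a type carries the subspace topology. -/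
def nontrivialConvergentSequences (X : Type*) [TopologicalSpace X] : Set (NonemptyCompacts X) :=
  {S | IsNontrivialConvergentSequence (S : Set X)}

/-! From hyperspace to `X`: a path of countable compact sets has a continuous selection through any
prescribed initial point (`exists_continuous_selection`), so a path from `K` to `L` joins each point
of `K` to some point of `L` inside any `U` containing the sets on the way
(`JoinedIn.exists_of_countable`). A nonconstant path has infinite compact range, hence carries a
convergent sequence `T` inside one path component. Joining a sequence through `q` to `T` (globally),
or `T ∪ {x, v}` to `T ∪ {x}` (locally, for `v` near `x`), connects `q` or `v` to that component.

From `X` to hyperspace: a Vietoris basic set given by finitely many path connected open sets is path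
connected (`joinedIn_convergentSequencesHitting`). Finite sets are adjoined by dragging points; then
one tail contracts to its limit while the other grows out of its own (`joinedIn_of_tendsto`). -/

open Set Filter Topology unitInterval

/-! ### Continuous selections for paths of countable compact sets. -/

section Selection

variable {X : Type*} [TopologicalSpace X]

theorem totallyDisconnectedSpace_of_countable_of_compact {K : Type*} [TopologicalSpace K]
    [T2Space K] [CompactSpace K] [Countable K] : TotallyDisconnectedSpace K := by
  refine ⟨fun s _ hs x hx y hy => ?_⟩
  by_contra hxy
  obtain ⟨f, hf0, hf1, -⟩ := exists_continuous_zero_one_of_isClosed (isClosed_singleton (x := x))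
    (isClosed_singleton (x := y)) (by simpa using hxy)
  have h := (s.to_countable.image f).isTotallyDisconnected (f '' s) subset_rfl
    (hs.image f f.continuous.continuousOn) (mem_image_of_mem f hx) (mem_image_of_mem f hy)
  rw [hf0 rfl, hf1 rfl] at h
  simp at h

theorem IsCompact.exists_separation_of_countable [T2Space X] {K : Set X} (hK : IsCompact K) (hc : K.Countable)
    {z : X} (hz : z ∈ K) {U : Set X} (hU : IsOpen U) (hzU : z ∈ U) :
    ∃ A B : Set X, IsOpen A ∧ IsOpen B ∧ Disjoint A B ∧ K ⊆ A ∪ B ∧ z ∈ A ∧ A ⊆ U := by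
  have := isCompact_iff_compactSpace.mp hK
  have := hc.to_subtype
  have := totallyDisconnectedSpace_of_countable_of_compact (K := K)
  obtain ⟨V, hV, hzV, hVU⟩ := compact_exists_isClopen_in_isOpen (x := (⟨z, hz⟩ : K))
    (hU.preimage continuous_subtype_val) hzU
  have hd : Disjoint (Subtype.val '' V) (Subtype.val '' Vᶜ) :=
    (disjoint_image_iff Subtype.val_injective).mpr disjoint_compl_right
  obtain ⟨A, B, hA, hB, hVA, hVB, hAB⟩ := SeparatedNhds.of_isCompact_isCompact
    (hV.isClosed.isCompact.image continuous_subtype_val)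
    (hV.compl.isClosed.isCompact.image continuous_subtype_val) hd
  refine ⟨A ∩ U, B, hA.inter hU, hB, hAB.mono_left inter_subset_left, fun k hk => ?_,
    ⟨hVA ⟨_, hzV, rfl⟩, hzU⟩, inter_subset_right⟩
  by_cases h : (⟨k, hk⟩ : K) ∈ V
  · exact .inl ⟨hVA ⟨_, h, rfl⟩, hVU h⟩
  · exact .inr (hVB ⟨_, h, rfl⟩)

/-- The points `z ∈ κ s` and `w ∈ κ t` are linked if no separation of the union of all `κ r` with
`r ∈ [s, t]` into two disjoint open sets separates them. -/
def FiberLinked (κ : I → NonemptyCompacts X) (s t : I) (z w : X) : Prop :=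
  ∀ A B : Set X, IsOpen A → IsOpen B → Disjoint A B →
    (∀ r ∈ Icc s t, (κ r : Set X) ⊆ A ∪ B) → z ∈ A → w ∈ A

variable {κ : I → NonemptyCompacts X}

theorem FiberLinked.refl (s t : I) (z : X) : FiberLinked κ s t z z := fun _ _ _ _ _ _ h => h

theorem FiberLinked.trans {s t u : I} {z w v : X} (hst : s ≤ t) (htu : t ≤ u)
    (h₁ : FiberLinked κ s t z w) (h₂ : FiberLinked κ t u w v) : FiberLinked κ s u z v :=
  fun A B hA hB hAB hκ hz => h₂ A B hA hB hAB (fun r hr => hκ r ⟨hst.trans hr.1, hr.2⟩)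
    (h₁ A B hA hB hAB (fun r hr => hκ r ⟨hr.1, hr.2.trans htu⟩) hz)

theorem fiber_inter_nonempty (hκ : Continuous κ) {s t : I} (hst : s ≤ t) {z : X} (hz : z ∈ κ s)
    {A B : Set X} (hA : IsOpen A) (hB : IsOpen B) (hAB : Disjoint A B)
    (hcov : ∀ r ∈ Icc s t, (κ r : Set X) ⊆ A ∪ B) (hzA : z ∈ A) :
    ((κ t : Set X) ∩ A).Nonempty := by
  by_contra h
  have hc : IsPreconnected (Icc s t) := ordConnected_Icc.isPreconnected
  have hu : IsOpen {r | ((κ r : Set X) ∩ A).Nonempty} :=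
    (NonemptyCompacts.isOpen_inter_nonempty_of_isOpen hA).preimage hκ
  have hv : IsOpen {r | (κ r : Set X) ⊆ B} :=
    (NonemptyCompacts.isOpen_subsets_of_isOpen hB).preimage hκ
  have key : ∀ r ∈ Icc s t, ¬ ((κ r : Set X) ∩ A).Nonempty → (κ r : Set X) ⊆ B := by
    intro r hr hn x hx
    exact (hcov r hr hx).resolve_left fun hxA => hn ⟨x, hx, hxA⟩
  obtain ⟨r, -, ⟨x, hx, hxA⟩, hrB⟩ := hc _ _ hu hv (fun r hr => or_iff_not_imp_left.mpr (key r hr))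
    ⟨s, ⟨le_rfl, hst⟩, z, hz, hzA⟩ ⟨t, ⟨hst, le_rfl⟩, key t ⟨hst, le_rfl⟩ h⟩
  exact hAB.notMem_of_mem_left hxA (hrB hx)

/-- On `κ t`, lying in `A` means avoiding `B`, so the constraints on `w` are compact sets, directed
under intersection; each is nonempty because `[s, t]` is connected. -/
theorem exists_fiberLinked [T2Space X] (hκ : Continuous κ) {s t : I} (hst : s ≤ t) {z : X} (hz : z ∈ κ s) :
    ∃ w ∈ κ t, FiberLinked κ s t z w := by
  let ι := {p : Set X × Set X // IsOpen p.1 ∧ IsOpen p.2 ∧ Disjoint p.1 p.2 ∧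
    (∀ r ∈ Icc s t, (κ r : Set X) ⊆ p.1 ∪ p.2) ∧ z ∈ p.1}
  have : Nonempty ι := ⟨⟨(univ, ∅), isOpen_univ, isOpen_empty, by simp, by simp, trivial⟩⟩
  have heq : ∀ p : ι, (κ t : Set X) ∩ p.1.1 = (κ t : Set X) \ p.1.2 := by
    rintro ⟨⟨A, B⟩, hA, hB, hAB, hc, hzA⟩
    have := hc t ⟨hst, le_rfl⟩
    ext x
    exact ⟨fun h => ⟨h.1, hAB.notMem_of_mem_left h.2⟩,
      fun h => ⟨h.1, (this h.1).resolve_right h.2⟩⟩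
  have hcpt : ∀ p : ι, IsCompact ((κ t : Set X) ∩ p.1.1) := fun p => by
    rw [heq]
    exact (κ t).isCompact.diff p.2.2.1
  have hdir : Directed (· ⊇ ·) fun p : ι => (κ t : Set X) ∩ p.1.1 := by
    rintro ⟨⟨A, B⟩, hA, hB, hAB, hc, hzA⟩ ⟨⟨A', B'⟩, hA', hB', hAB', hc', hzA'⟩
    refine ⟨⟨(A ∩ A', B ∪ B'), hA.inter hA', hB.union hB', ?_, fun r hr x hx => ?_, hzA, hzA'⟩,
      ?_, ?_⟩
    · rw [disjoint_union_right]
      exact ⟨hAB.mono_left inter_subset_left, hAB'.mono_left inter_subset_right⟩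
    · have h1 := hc r hr hx
      have h2 := hc' r hr hx
      simp only [mem_union, mem_inter_iff] at h1 h2 ⊢
      tauto
    · exact inter_subset_inter_right _ inter_subset_left
    · exact inter_subset_inter_right _ inter_subset_right
  obtain ⟨w, hw⟩ := IsCompact.nonempty_iInter_of_directed_nonempty_isCompact_isClosed
    (fun p : ι => (κ t : Set X) ∩ p.1.1) hdir
    (fun p => fiber_inter_nonempty hκ hst hz p.2.1 p.2.2.1 p.2.2.2.1 p.2.2.2.2.1 p.2.2.2.2.2)
    hcpt (fun p => (hcpt p).isClosed)
  rw [mem_iInter] at hw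
  exact ⟨w, (hw (Classical.arbitrary ι)).1,
    fun A B hA hB hAB hc hzA => (hw ⟨(A, B), hA, hB, hAB, hc, hzA⟩).2⟩

theorem exists_selection_on_finset [T2Space X] (hκ : Continuous κ) {p : X} (hp : p ∈ κ 0) (D : Finset I) :
    ∃ f : I → X, (∀ t, f t ∈ κ t) ∧ f 0 = p ∧
      ∀ s ∈ insert 0 D, ∀ t ∈ insert 0 D, s ≤ t → FiberLinked κ s t (f s) (f t) := by
  induction D using Finset.induction_on_max with
  | empty =>
    choose g hg using fun t => (κ t).nonempty
    refine ⟨Function.update g 0 p, fun t => ?_, by simp, ?_⟩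
    · by_cases h : t = 0
      · subst h; simpa using hp
      · simpa [h] using hg t
    · simp [FiberLinked.refl]
  | insert a D hmax ih =>
    obtain ⟨f, hf, hf0, hfl⟩ := ih
    by_cases ha : a = 0
    · subst ha
      exact ⟨f, hf, hf0, by simpa using hfl⟩
    have hlt : ∀ x ∈ insert 0 D, x < a := by
      intro x hx
      rcases Finset.mem_insert.mp hx with rfl | hx
      · exact lt_of_le_of_ne unitInterval.nonneg' (Ne.symm ha)
      · exact hmax x hx
    -- Linking the new point to the last earlier one suffices, by transitivity.
    set m := (insert 0 D).max' ⟨0, Finset.mem_insert_self _ _⟩ with hm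
    have hmm : m ∈ insert 0 D := Finset.max'_mem _ _
    obtain ⟨w, hw, hmw⟩ := exists_fiberLinked hκ (hlt m hmm).le (hf m)
    refine ⟨Function.update f a w, fun t => ?_, ?_, ?_⟩
    · by_cases h : t = a
      · subst h; simpa using hw
      · simpa [h] using hf t
    · rw [Function.update_of_ne (Ne.symm ha), hf0]
    · rw [Finset.insert_comm]
      intro s hs t ht hst
      rcases Finset.mem_insert.mp hs with rfl | hs' <;> rcases Finset.mem_insert.mp ht with rfl | ht'
      · exact .refl _ _ _
      · exact absurd hst (hlt t ht').not_ge
      · rw [Function.update_of_ne (hlt s hs').ne, Function.update_self]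
        have hsm : s ≤ m := Finset.le_max' _ _ hs'
        exact (hfl s hs' m hmm hsm).trans hsm (hlt m hmm).le hmw
      · rw [Function.update_of_ne (hlt s hs').ne, Function.update_of_ne (hlt t ht').ne]
        exact hfl s hs' t ht' hst

/-- For selections, `f t ∈ A` is the same as `f t ∉ B`, which turns an open condition into a closed
one and permits compactness in the product. -/
theorem isClosed_fiberLinked [T2Space X] (κ : I → NonemptyCompacts X) {s t : I} (hst : s ≤ t) :
    IsClosed {f : I → X | f ∈ univ.pi (fun r => (κ r : Set X)) ∧
      FiberLinked κ s t (f s) (f t)} := by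
  have : {f : I → X | f ∈ univ.pi (fun r => (κ r : Set X)) ∧ FiberLinked κ s t (f s) (f t)} =
      univ.pi (fun r => (κ r : Set X)) ∩ ⋂ (A : Set X) (B : Set X) (_ : IsOpen A) (_ : IsOpen B)
        (_ : Disjoint A B) (_ : ∀ r ∈ Icc s t, (κ r : Set X) ⊆ A ∪ B),
        {f : I → X | f s ∈ A → f t ∉ B} := by
    ext f
    simp only [FiberLinked, mem_ofPred_eq, mem_inter_iff, mem_iInter]
    refine and_congr_right fun hf => ?_
    refine forall₂_congr fun A B => forall₄_congr fun hA hB hAB hc =>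
      imp_congr_right fun _ => ⟨fun h => hAB.notMem_of_mem_left h, fun h => ?_⟩
    exact (hc t ⟨hst, le_rfl⟩ (hf t trivial)).resolve_right h
  rw [this]
  refine (isClosed_set_pi fun r _ => (κ r).isCompact.isClosed).inter ?_
  refine isClosed_iInter fun A => isClosed_iInter fun B => isClosed_iInter fun hA =>
    isClosed_iInter fun hB => isClosed_iInter fun _ => isClosed_iInter fun _ => ?_
  exact isClosed_imp (hA.preimage (continuous_apply s))
    (hB.preimage (continuous_apply t)).isClosed_compl

/-- A continuous family of countable compact sets over the unit interval has a continuous selection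
with any prescribed initial value. -/
theorem exists_continuous_selection [T2Space X] (hκ : Continuous κ) (hc : ∀ t, (κ t : Set X).Countable)
    {p : X} (hp : p ∈ κ 0) :
    ∃ f : I → X, Continuous f ∧ f 0 = p ∧ ∀ t, f t ∈ κ t := by
  let F : Finset I → Set (I → X) := fun D => {f | f ∈ univ.pi (fun r => (κ r : Set X)) ∧ f 0 = p ∧
    ∀ s ∈ D, ∀ t ∈ D, s ≤ t → FiberLinked κ s t (f s) (f t)}
  have hFanti : Antitone F := fun D D' h f hf =>
    ⟨hf.1, hf.2.1, fun s hs t ht => hf.2.2 s (h hs) t (h ht)⟩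
  have hFclosed : ∀ D, IsClosed (F D) := by
    intro D
    have : F D = (univ.pi (fun r => (κ r : Set X)) ∩ {f | f 0 = p}) ∩ ⋂ s ∈ D, ⋂ t ∈ D,
        ⋂ _ : s ≤ t, {f : I → X | f ∈ univ.pi (fun r => (κ r : Set X)) ∧
          FiberLinked κ s t (f s) (f t)} := by
      ext f
      simp only [F, mem_ofPred_eq, mem_inter_iff, mem_iInter]
      grind
    rw [this]
    refine ((isClosed_set_pi fun r _ => (κ r).isCompact.isClosed).inter
      (isClosed_eq (continuous_apply 0) continuous_const)).inter ?_
    exact isClosed_biInter fun s _ => isClosed_biInter fun t _ => isClosed_iInter fun hst =>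
      isClosed_fiberLinked κ hst
  have hFcompact : ∀ D, IsCompact (F D) := fun D =>
    (isCompact_univ_pi fun r => (κ r).isCompact).of_isClosed_subset (hFclosed D) fun f hf => hf.1
  obtain ⟨f, hf⟩ := IsCompact.nonempty_iInter_of_directed_nonempty_isCompact_isClosed F
    hFanti.directed_ge (fun D => by
      obtain ⟨f, h1, h2, h3⟩ := exists_selection_on_finset hκ hp D
      exact ⟨f, fun r _ => h1 r, h2, fun s hs t ht =>
        h3 s (Finset.mem_insert_of_mem hs) t (Finset.mem_insert_of_mem ht)⟩) hFcompact hFclosed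
  rw [mem_iInter] at hf
  have hfκ : ∀ t, f t ∈ κ t := fun t => (hf ∅).1 t trivial
  have hfl : ∀ s t, s ≤ t → FiberLinked κ s t (f s) (f t) := fun s t =>
    (hf {s, t}).2.2 s (by simp) t (by simp)
  refine ⟨f, continuous_iff_continuousAt.mpr fun t => ?_, (hf ∅).2.1, hfκ⟩
  rw [ContinuousAt, tendsto_def]
  intro U hU
  obtain ⟨U', hU'U, hU', htU'⟩ := mem_nhds_iff.mp hU
  -- The cover of `κ t` by `A` and `B` persists for nearby parameters, and linking then keeps `f` in
  -- `A`; to the left of `t`, the roles of `A` and `B` are exchanged.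
  obtain ⟨A, B, hA, hB, hAB, hcov, htA, hAU⟩ :=
    (κ t).isCompact.exists_separation_of_countable (hc t) (hfκ t) hU' htU'
  have hnhds : {r | (κ r : Set X) ⊆ A ∪ B} ∈ 𝓝 t :=
    ((NonemptyCompacts.isOpen_subsets_of_isOpen (hA.union hB)).preimage hκ).mem_nhds hcov
  obtain ⟨b, c, -, hJt, hJ⟩ := exists_Icc_mem_subset_of_mem_nhds hnhds
  have hJc : (Icc b c).OrdConnected := ordConnected_Icc
  filter_upwards [hJt] with r hr
  refine hU'U (hAU ?_)
  rcases le_total t r with htr | hrt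
  · exact hfl t r htr A B hA hB hAB (fun q hq => hJ (hJc.out (mem_of_mem_nhds hJt) hr hq)) htA
  · refine (hJ hr (hfκ r)).resolve_right fun hrB => ?_
    refine hAB.notMem_of_mem_left htA (hfl r t hrt B A hB hA hAB.symm (fun q hq => ?_) hrB)
    rw [union_comm]
    exact hJ (hJc.out hr (mem_of_mem_nhds hJt) hq)

theorem JoinedIn.exists_of_countable [T2Space X] {S : Set (NonemptyCompacts X)} {K L : NonemptyCompacts X}
    (h : JoinedIn S K L) {U : Set X} (hS : ∀ M ∈ S, (M : Set X).Countable ∧ (M : Set X) ⊆ U)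
    {p : X} (hp : p ∈ K) : ∃ q ∈ L, JoinedIn U p q := by
  obtain ⟨γ, hγ⟩ := h
  obtain ⟨f, hf, hf0, hfκ⟩ := exists_continuous_selection γ.continuous
    (fun t => (hS _ (hγ t)).1) (by simpa using hp)
  exact ⟨f 1, by simpa using hfκ 1, ⟨⟨⟨f, hf⟩, hf0, rfl⟩, fun t => (hS _ (hγ t)).2 (hfκ t)⟩⟩

end Selection

/-! ### Convergent sequences, and descent of path connectedness to `X`. -/

section ConvergentSequences

variable {X : Type*} [TopologicalSpace X]

theorem isNontrivialConvergentSequence_of_tendsto {u : ℕ → X} {x : X} (hu : Tendsto u atTop (𝓝 x))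
    (hinf : (range u).Infinite) : IsNontrivialConvergentSequence (insert x (range u)) := by
  refine ⟨(countable_range u).insert x, hinf.mono (subset_insert _ _), x, mem_insert _ _,
    fun U hU hx => ?_⟩
  obtain ⟨N, hN⟩ := (hu.eventually (hU.mem_nhds hx)).exists_forall_of_atTop
  refine ((finite_lt_nat N).image u).subset ?_
  rintro _ ⟨rfl | ⟨n, rfl⟩, hn⟩
  · exact absurd hx hn
  · exact ⟨n, lt_of_not_ge fun h => hn (hN n h), rfl⟩

namespace IsNontrivialConvergentSequence

variable {S : Set X}

theorem union_finite (hS : IsNontrivialConvergentSequence S) {E : Set X} (hE : E.Finite) :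
    IsNontrivialConvergentSequence (S ∪ E) := by
  obtain ⟨hc, hi, x, hx, h⟩ := hS
  refine ⟨hc.union hE.countable, hi.mono subset_union_left, x, .inl hx, fun U hU hxU => ?_⟩
  rw [union_sdiff_distrib]
  exact (h U hU hxU).union hE.sdiff

theorem exists_seq {x : X} (hc : S.Countable) (hi : S.Infinite) (hx : x ∈ S)
    (h : ∀ U : Set X, IsOpen U → x ∈ U → (S \ U).Finite) {V : Set X} (hV : IsOpen V) (hxV : x ∈ V) :
    ∃ u : ℕ → X, Function.Injective u ∧ Tendsto u atTop (𝓝 x) ∧ (∀ n, u n ∈ V) ∧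
      ∃ E : Set X, E.Finite ∧ S = insert x (range u) ∪ E := by
  have hinf : (S ∩ V).Infinite := by
    intro hfin
    exact hi (by simpa [inter_union_sdiff] using hfin.union (h V hV hxV))
  have hinf' := hinf.sdiff (finite_singleton x)
  have := hinf'.to_subtype
  have := ((hc.mono inter_subset_left).mono (sdiff_subset (s := S ∩ V) (t := {x}))).to_subtype
  obtain ⟨e⟩ := nonempty_equiv_of_countable (α := ℕ) (β := ↥((S ∩ V) \ {x} : Set X))
  have hinj : Function.Injective fun n => (e n : X) := Subtype.val_injective.comp e.injective
  refine ⟨fun n => e n, hinj, ?_, fun n => (e n).2.1.2, S \ V, h V hV hxV, ?_⟩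
  · rw [← Nat.cofinite_eq_atTop, tendsto_def]
    intro U hU
    obtain ⟨W, hWU, hW, hxW⟩ := mem_nhds_iff.mp hU
    refine mem_of_superset ?_ (preimage_mono hWU)
    rw [mem_cofinite]
    refine ((h W hW hxW).preimage hinj.injOn).subset fun n hn => ⟨(e n).2.1.1, hn⟩
  · ext y
    constructor
    · intro hy
      by_cases hyV : y ∈ V
      · by_cases hyx : y = x
        · exact .inl (.inl hyx)
        · obtain ⟨n, hn⟩ := e.surjective ⟨y, ⟨hy, hyV⟩, hyx⟩
          exact .inl (.inr ⟨n, by simp [hn]⟩)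
      · exact .inr ⟨hy, hyV⟩
    · rintro ((rfl | ⟨n, rfl⟩) | hy)
      · exact hx
      · exact (e n).2.1.1
      · exact hy.1

theorem isCompact (hS : IsNontrivialConvergentSequence S) : IsCompact S := by
  obtain ⟨hc, hi, x, hx, h⟩ := hS
  obtain ⟨u, -, hu, -, E, hE, rfl⟩ := exists_seq hc hi hx h isOpen_univ trivial
  exact hu.isCompact_insert_range.union hE.isCompact

/-- A nontrivial convergent sequence as a nonempty compact set. -/
def toNonemptyCompacts (hS : IsNontrivialConvergentSequence S) : NonemptyCompacts X :=
  ⟨⟨S, hS.isCompact⟩, hS.2.1.nonempty⟩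

@[simp]
theorem coe_toNonemptyCompacts (hS : IsNontrivialConvergentSequence S) :
    (hS.toNonemptyCompacts : Set X) = S := rfl

theorem toNonemptyCompacts_mem (hS : IsNontrivialConvergentSequence S) :
    hS.toNonemptyCompacts ∈ nontrivialConvergentSequences X := hS

end IsNontrivialConvergentSequence

theorem IsCompact.exists_isNontrivialConvergentSequence_subset [T1Space X]
    [FirstCountableTopology X] {K : Set X} (hK : IsCompact K) (hi : K.Infinite) :
    ∃ T ⊆ K, IsNontrivialConvergentSequence T := by
  obtain ⟨a, haK, ha⟩ := hi.exists_accPt_of_subset_isCompact hK subset_rfl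
  rw [accPt_iff_clusterPt, inf_principal, ← mem_closure_iff_clusterPt, mem_closure_iff_seq_limit] at ha
  obtain ⟨u, huK, hu⟩ := ha
  refine ⟨insert a (range u), insert_subset haK (range_subset_iff.mpr fun n => (huK n).2),
    isNontrivialConvergentSequence_of_tendsto hu fun hfin => ?_⟩
  have := hfin.isClosed.mem_of_tendsto hu (.of_forall fun n => mem_range_self n)
  obtain ⟨n, hn⟩ := this
  exact (huK n).1 hn

theorem JoinedIn.exists_isNontrivialConvergentSequence [T1Space X] [FirstCountableTopology X]
    {U : Set X} {x y : X} (h : JoinedIn U x y) (hxy : x ≠ y) :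
    ∃ T ⊆ pathComponentIn U x, IsNontrivialConvergentSequence T := by
  obtain ⟨γ, hγ⟩ := h
  have hi : (range γ).Infinite := (isPreconnected_range γ.continuous).infinite_of_nontrivial
    ⟨x, ⟨0, γ.source⟩, y, ⟨1, γ.target⟩, hxy⟩
  obtain ⟨T, hT, hT'⟩ :=
    (isCompact_range γ.continuous).exists_isNontrivialConvergentSequence_subset hi
  have : PathConnectedSpace I := isPathConnected_iff_pathConnectedSpace.mp
    ((convex_Icc (0 : ℝ) 1).isPathConnected ⟨0, unitInterval.zero_mem⟩)
  refine ⟨T, hT.trans ?_, hT'⟩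
  exact (isPathConnected_range γ.continuous).subset_pathComponentIn ⟨0, γ.source⟩
    (range_subset_iff.mpr hγ)

theorem exists_ne_joinedIn [T1Space X] [PathConnectedSpace X] [Nontrivial X] {x : X} {U : Set X}
    (hU : IsOpen U) (hx : x ∈ U) : ∃ w, w ≠ x ∧ JoinedIn U x w := by
  by_contra! hcon
  obtain ⟨y, hy⟩ := exists_ne x
  let γ := PathConnectedSpace.somePath x y
  have hγ : Continuous γ.extend := γ.continuous_extend
  -- A short piece of `γ` around a visit to `x` stays in `U`, so it must be constant; the fibre over
  -- `x` is then clopen in `ℝ`.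
  have hopen : IsOpen {t | γ.extend t = x} := by
    rw [isOpen_iff_mem_nhds]
    intro t ht
    have ht' : γ.extend t = x := ht
    have hmem : γ.extend ⁻¹' U ∈ 𝓝 t := (hU.preimage hγ).mem_nhds (by rwa [mem_preimage, ht'])
    filter_upwards [pathComponentIn_mem_nhds hmem] with r hr
    by_contra hne
    have := (JoinedIn.map hr hγ).mono (image_preimage_subset _ _)
    rw [ht'] at this
    exact hcon _ hne this
  have := IsClopen.eq_univ (s := γ.extend ⁻¹' {x}) ⟨isClosed_singleton.preimage hγ, hopen⟩ ⟨0, γ.extend_zero⟩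
  have h1 : (1 : ℝ) ∈ γ.extend ⁻¹' {x} := this ▸ mem_univ 1
  exact hy (γ.extend_one.symm.trans h1)

theorem pathConnectedSpace_of_nontrivialConvergentSequences [T2Space X] [FirstCountableTopology X]
    [PathConnectedSpace (nontrivialConvergentSequences X)] : PathConnectedSpace X := by
  have hpc : IsPathConnected (nontrivialConvergentSequences X) :=
    isPathConnected_iff_pathConnectedSpace.mpr inferInstance
  have hcU : ∀ M ∈ nontrivialConvergentSequences X,
      (M : Set X).Countable ∧ (M : Set X) ⊆ univ := fun M hM => ⟨hM.1, subset_univ _⟩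
  obtain ⟨K, hK⟩ := hpc.nonempty
  obtain ⟨hc, hi, x, hx, h⟩ := id hK
  obtain ⟨z, hz, hzx⟩ := hi.nontrivial.exists_ne x
  have hS' : IsNontrivialConvergentSequence ((K : Set X) \ {z}) :=
    ⟨hc.mono sdiff_subset, hi.sdiff (finite_singleton z), x, ⟨hx, hzx.symm⟩,
      fun U hU hxU => (h U hU hxU).subset (sdiff_subset_sdiff_left sdiff_subset)⟩
  -- Deleting `z` forces the selected path from `z` to end at a different point.
  obtain ⟨w, hw, hzw⟩ := (hpc.joinedIn K hK _ hS'.toNonemptyCompacts_mem).exists_of_countable hcU hz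
  obtain ⟨T, hTz, hT⟩ := hzw.exists_isNontrivialConvergentSequence (Ne.symm hw.2)
  have key : ∀ q, Joined z q := by
    intro q
    have hq := IsNontrivialConvergentSequence.union_finite hK (finite_singleton q)
    obtain ⟨v, hv, hqv⟩ := (hpc.joinedIn _ hq.toNonemptyCompacts_mem _
      hT.toNonemptyCompacts_mem).exists_of_countable hcU (p := q) (.inr rfl)
    exact (hTz hv).joined.trans hqv.joined.symm
  exact ⟨⟨z⟩, fun p q => (key p).symm.trans (key q)⟩

theorem locallyPathConnectedSpace_of_nontrivialConvergentSequences [T2Space X]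
    [FirstCountableTopology X] [PathConnectedSpace X] [Nontrivial X]
    [LocallyPathConnectedSpace (nontrivialConvergentSequences X)] :
    LocallyPathConnectedSpace X := by
  rw [locallyPathConnectedSpace_iff_pathComponentIn_mem_nhds]
  intro x U hU hx
  obtain ⟨w, hwx, hw⟩ := exists_ne_joinedIn hU hx
  obtain ⟨T, hTU, hT⟩ := hw.exists_isNontrivialConvergentSequence hwx.symm
  have hK := hT.union_finite (finite_singleton x)
  have hKU : (T ∪ {x}) ⊆ pathComponentIn U x :=
    union_subset hTU (singleton_subset_iff.mpr (mem_pathComponentIn_self hx))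
  let K : nontrivialConvergentSequences X := ⟨hK.toNonemptyCompacts, hK⟩
  let f : X → nontrivialConvergentSequences X := fun v =>
    ⟨K.1 ⊔ {v}, hK.union_finite (finite_singleton v)⟩
  have hf : Continuous f :=
    (continuous_const.sup NonemptyCompacts.continuous_singleton).subtype_mk _
  have hfx : f x = K := by
    refine Subtype.ext (NonemptyCompacts.ext ?_)
    simp [f, K]
  let O : Set (nontrivialConvergentSequences X) := {M | (M.1 : Set X) ⊆ U}
  have hO : IsOpen O :=
    (NonemptyCompacts.isOpen_subsets_of_isOpen hU).preimage continuous_subtype_val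
  have hKO : O ∈ 𝓝 (f x) := hO.mem_nhds (hfx ▸ hKU.trans pathComponentIn_subset)
  filter_upwards [hf.continuousAt (pathComponentIn_mem_nhds hKO)] with v hv
  have hj := (JoinedIn.map hv continuous_subtype_val).symm
  obtain ⟨q, hq, hvq⟩ := hj.exists_of_countable (U := U) (p := v)
    (by rintro _ ⟨M, hM, rfl⟩; exact ⟨M.2.1, hM⟩) (.inr rfl)
  rw [hfx] at hq
  exact (hKU hq).trans hvq.symm

end ConvergentSequences

/-! ### Paths in the hyperspace. -/

section Hyperspace

variable {X : Type*} [TopologicalSpace X]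

/-- Uniform convergence to `x` leaves only finitely many conditions `g n y ∈ U` to check for an open
`U` containing `x`. -/
theorem exists_continuous_insert_range {Y : Type*} [TopologicalSpace Y] {g : ℕ → Y → X}
    (hg : ∀ n, Continuous (g n)) {x : X} (h : ∀ U ∈ 𝓝 x, ∀ᶠ n in atTop, ∀ y, g n y ∈ U) :
    ∃ A : Y → NonemptyCompacts X, Continuous A ∧
      ∀ y, (A y : Set X) = insert x (range fun n => g n y) := by
  have ht : ∀ y, Tendsto (fun n => g n y) atTop (𝓝 x) := fun y => tendsto_def.mpr fun U hU =>
    (h U hU).mono fun n hn => hn y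
  refine ⟨fun y => ⟨⟨_, (ht y).isCompact_insert_range⟩, ⟨x, mem_insert _ _⟩⟩, ?_, fun y => rfl⟩
  let _ := TopologicalSpace.vietoris X
  refine NonemptyCompacts.isEmbedding_coe.continuous_iff.mpr (vietoris.continuous_iff.mpr ⟨?_, ?_⟩)
  · intro U hU
    by_cases hx : x ∈ U
    · obtain ⟨N, hN⟩ := (h U (hU.mem_nhds hx)).exists_forall_of_atTop
      convert! (finite_lt_nat N).isOpen_biInter fun n _ => hU.preimage (hg n) using 1
      ext y
      simp only [mem_preimage, Function.comp_apply, mem_powerset_iff, mem_iInter]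
      constructor
      · exact fun hs n _ => hs (.inr ⟨n, rfl⟩)
      · rintro hs _ (rfl | ⟨n, rfl⟩)
        · exact hx
        · exact (lt_or_ge n N).elim (hs n) fun hn => hN n hn y
    · convert! isOpen_empty using 1
      exact eq_empty_of_forall_notMem fun y hy => hx (hy (mem_insert _ _))
  · intro F hF
    by_cases hx : x ∈ F
    · convert! isClosed_iInter fun n => hF.preimage (hg n) using 1
      ext y
      simp only [mem_preimage, Function.comp_apply, mem_powerset_iff, mem_iInter]
      constructor
      · exact fun hs n => hs (.inr ⟨n, rfl⟩)
      · rintro hs _ (rfl | ⟨n, rfl⟩)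
        · exact hx
        · exact hs n
    · convert! isClosed_empty using 1
      exact eq_empty_of_forall_notMem fun y hy => hx (hy (mem_insert _ _))

/-- The path from `u n` is taken in the deepest `W k`, `k ≤ n`, where one exists. Local path
connectedness makes this depth tend to infinity. Level `0` is `V`, so some level is always
available. -/
theorem exists_paths_of_tendsto [FirstCountableTopology X] [LocallyPathConnectedSpace X]
    {V : Set X} (hV : IsOpen V) (hVc : IsPathConnected V) {u : ℕ → X} {x : X}
    (hu : Tendsto u atTop (𝓝 x)) (huV : ∀ n, u n ∈ V) (hx : x ∈ V) :
    ∃ γ : ∀ n, Path (u n) x, (∀ n t, γ n t ∈ V) ∧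
      ∀ U ∈ 𝓝 x, ∀ᶠ n in atTop, ∀ t, γ n t ∈ U := by
  classical
  obtain ⟨b, hb⟩ := (𝓝 x).exists_antitone_basis
  let W : ℕ → Set X := fun k => Nat.rec V (fun j _ => V ∩ b j) k
  let P : ℕ → ℕ → Prop := fun n k => JoinedIn (W k) (u n) x
  have hWV : ∀ k, W k ⊆ V := by
    rintro (_ | k)
    · exact subset_rfl
    · exact inter_subset_left
  have hP0 : ∀ n, P n 0 := fun n => hVc.joinedIn _ (huV n) _ hx
  have hP : ∀ k, ∀ᶠ n in atTop, P n (k + 1) := fun k =>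
    (hu.eventually (pathComponentIn_mem_nhds (inter_mem (hV.mem_nhds hx) (hb.mem k)))).mono
      fun n hn => JoinedIn.symm hn
  have hspec : ∀ n, P n (Nat.findGreatest (P n) n) := fun n =>
    Nat.findGreatest_spec (Nat.zero_le n) (hP0 n)
  choose γ hγ using hspec
  refine ⟨γ, fun n t => hWV _ (hγ n t), fun U hU => ?_⟩
  obtain ⟨k, hk⟩ := hb.mem_iff.mp hU
  filter_upwards [hP k, eventually_ge_atTop (k + 1)] with n hn hkn t
  have hle : k + 1 ≤ Nat.findGreatest (P n) n := Nat.le_findGreatest hkn hn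
  have hmem := hγ n t
  obtain ⟨j, hj⟩ := Nat.exists_eq_add_of_le' (Nat.one_le_of_lt hle)
  rw [hj] at hmem hle
  exact hk (hb.antitone (Nat.le_of_succ_le_succ hle) hmem.2)

/-- The nontrivial convergent sequences that are covered by the family `𝒱` and meet each of its
members. -/
def convergentSequencesHitting (𝒱 : Set (Set X)) : Set (NonemptyCompacts X) :=
  {K | IsNontrivialConvergentSequence (K : Set X) ∧ (K : Set X) ⊆ ⋃₀ 𝒱 ∧
    ∀ V ∈ 𝒱, ((K : Set X) ∩ V).Nonempty}

variable {𝒱 : Set (Set X)}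

theorem joinedIn_union_singleton {V : Set X} (hV : V ∈ 𝒱) (hVc : IsPathConnected V)
    {K : NonemptyCompacts X} (hK : K ∈ convergentSequencesHitting 𝒱) {e : X} (he : e ∈ V) :
    JoinedIn (convergentSequencesHitting 𝒱) K (K ⊔ {e}) := by
  obtain ⟨s, hsK, hsV⟩ := hK.2.2 V hV
  obtain ⟨γ, hγ⟩ := hVc.joinedIn s hsV e he
  refine ⟨⟨⟨fun t => K ⊔ {γ t}, continuous_const.sup
    (NonemptyCompacts.continuous_singleton.comp γ.continuous)⟩, ?_, ?_⟩, fun t => ?_⟩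
  · refine NonemptyCompacts.ext ?_
    simpa using hsK
  · simp
  · refine ⟨hK.1.union_finite (finite_singleton (γ t)), ?_, fun W hW => ?_⟩
    · exact union_subset hK.2.1 (singleton_subset_iff.mpr ⟨V, hV, hγ t⟩)
    · exact (hK.2.2 W hW).mono (inter_subset_inter_left _ subset_union_left)

theorem joinedIn_union_finite (h𝒱 : ∀ V ∈ 𝒱, IsPathConnected V) {K : NonemptyCompacts X}
    (hK : K ∈ convergentSequencesHitting 𝒱) {E : Set X} (hE : E.Finite) (hE𝒱 : E ⊆ ⋃₀ 𝒱) :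
    ∀ L : NonemptyCompacts X, (L : Set X) = (K : Set X) ∪ E →
      JoinedIn (convergentSequencesHitting 𝒱) K L := by
  induction E, hE using Set.Finite.induction_on with
  | empty =>
    intro L hL
    obtain rfl : L = K := NonemptyCompacts.ext (by simpa using hL)
    exact .refl hK
  | @insert e E _ hE ih =>
    intro L hL
    obtain ⟨V, hV, heV⟩ := hE𝒱 (mem_insert e E)
    let M : NonemptyCompacts X :=
      ⟨⟨(K : Set X) ∪ E, K.isCompact.union hE.isCompact⟩, K.nonempty.mono subset_union_left⟩
    have hM := ih ((subset_insert e E).trans hE𝒱) M rfl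
    have := joinedIn_union_singleton hV (h𝒱 V hV) hM.target_mem heV
    convert! hM.trans this
    refine NonemptyCompacts.ext ?_
    rw [hL, NonemptyCompacts.coe_sup]
    ext z
    simp [M]

theorem joinedIn_of_tendsto [FirstCountableTopology X] [LocallyPathConnectedSpace X]
    (h𝒱 : ∀ V ∈ 𝒱, IsOpen V ∧ IsPathConnected V) {V W : Set X} (hV : V ∈ 𝒱) (hW : W ∈ 𝒱)
    {u v : ℕ → X} {x y : X} (hu : Tendsto u atTop (𝓝 x)) (hv : Tendsto v atTop (𝓝 y))
    (hui : Function.Injective u) (hvi : Function.Injective v) (huV : ∀ n, u n ∈ V)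
    (hvW : ∀ n, v n ∈ W) (hxV : x ∈ V) (hyW : y ∈ W) {E : Set X} (hE : E.Finite)
    (hE𝒱 : E ⊆ ⋃₀ 𝒱) (hEhit : ∀ V ∈ 𝒱, (E ∩ V).Nonempty) (hxE : x ∈ E) (hyE : y ∈ E)
    {K L : NonemptyCompacts X} (hK : (K : Set X) = insert x (range u) ∪ E)
    (hL : (L : Set X) = insert y (range v) ∪ E) :
    JoinedIn (convergentSequencesHitting 𝒱) K L := by
  obtain ⟨γ, hγV, hγ⟩ := exists_paths_of_tendsto (h𝒱 V hV).1 (h𝒱 V hV).2 hu huV hxV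
  obtain ⟨δ, hδW, hδ⟩ := exists_paths_of_tendsto (h𝒱 W hW).1 (h𝒱 W hW).2 hv hvW hyW
  -- The speed `n + 1` ensures that at each `t > 0` all but finitely many paths are finished: the
  -- limit is `x` at `t = 0` and `y` at every `t > 0`, and the set is never finite.
  let g : ℕ → I → X := fun n t => (γ n).extend ((n + 1) * t)
  let d : ℕ → I → X := fun n t => (δ n).symm.extend ((n + 1) * t)
  have hgr : ∀ n t, ∃ s, g n t = γ n s := fun n t => ⟨_, rfl⟩
  have hdr : ∀ n t, ∃ s, d n t = δ n s := fun n t => ⟨_, rfl⟩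
  have hg1 : ∀ (n : ℕ) (t : I), 1 ≤ (n + 1) * (t : ℝ) → g n t = x := fun n t h => (γ n).extend_of_one_le h
  have hd1 : ∀ (n : ℕ) (t : I), 1 ≤ (n + 1) * (t : ℝ) → d n t = v n := fun n t h =>
    (δ n).symm.extend_of_one_le h
  have hg0 : ∀ n, g n 0 = u n := fun n => by simp [g]
  have hd0 : ∀ n, d n 0 = y := fun n => by simp [d]
  have hdy : ∀ U ∈ 𝓝 y, ∀ᶠ n in atTop, ∀ t, d n t ∈ U := fun U hU =>
    (hδ U hU).mono fun n hn t => by obtain ⟨s, hs⟩ := hdr n t; exact hs ▸ hn s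
  obtain ⟨A, hA, hAr⟩ := exists_continuous_insert_range (g := g) (x := x)
    (fun n => (γ n).continuous_extend.comp (by fun_prop)) (fun U hU =>
      (hγ U hU).mono fun n hn t => by obtain ⟨s, hs⟩ := hgr n t; exact hs ▸ hn s)
  obtain ⟨B, hB, hBr⟩ := exists_continuous_insert_range (g := d) (x := y)
    (fun n => (δ n).symm.continuous_extend.comp (by fun_prop)) hdy
  let F : NonemptyCompacts X := ⟨⟨E, hE.isCompact⟩, ⟨x, hxE⟩⟩
  have hcoe : ∀ t, ((A t ⊔ B t ⊔ F : NonemptyCompacts X) : Set X) =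
      insert x (range fun n => g n t) ∪ insert y (range fun n => d n t) ∪ E := fun t => by
    rw [NonemptyCompacts.coe_sup, NonemptyCompacts.coe_sup, hAr, hBr]
    rfl
  have h0 : A 0 ⊔ B 0 ⊔ F = K := by
    refine NonemptyCompacts.ext ?_
    rw [hcoe, hK]
    simp only [hg0, hd0, range_const]
    grind
  have h1 : A 1 ⊔ B 1 ⊔ F = L := by
    refine NonemptyCompacts.ext ?_
    have hg1' : ∀ n, g n 1 = x := fun n => hg1 n 1 (by simp)
    have hd1' : ∀ n, d n 1 = v n := fun n => hd1 n 1 (by simp)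
    rw [hcoe, hL]
    simp only [hg1', hd1', range_const]
    grind
  refine ⟨⟨⟨fun t => A t ⊔ B t ⊔ F, (hA.sup hB).sup continuous_const⟩, h0, h1⟩, fun t => ?_⟩
  refine ⟨?_, ?_, fun V hV => ?_⟩
  · change IsNontrivialConvergentSequence ((A t ⊔ B t ⊔ F : NonemptyCompacts X) : Set X)
    by_cases ht : t = 0
    · rw [ht, h0, hK]
      exact (isNontrivialConvergentSequence_of_tendsto hu
        (infinite_range_of_injective hui)).union_finite hE
    · have htpos : (0 : ℝ) < t := lt_of_le_of_ne t.2.1 fun h => ht (Subtype.ext h.symm)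
      obtain ⟨N, hN⟩ := exists_nat_ge (1 / (t : ℝ))
      have hlarge : ∀ n ≥ N, 1 ≤ (n + 1) * (t : ℝ) := by
        intro n hn
        rw [div_le_iff₀ htpos] at hN
        have : (N : ℝ) ≤ n := by exact_mod_cast hn
        nlinarith
      have hfin : (insert x (range fun n => g n t)).Finite := by
        refine (((finite_lt_nat N).image fun n => g n t).insert x).subset ?_
        rintro _ (rfl | ⟨n, rfl⟩)
        · exact .inl rfl
        · rcases lt_or_ge n N with hn | hn
          · exact .inr ⟨n, hn, rfl⟩
          · exact .inl (hg1 n t (hlarge n hn))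
      have hinf : (range fun n => d n t).Infinite := by
        refine ((Set.Ici_infinite N).image hvi.injOn).mono ?_
        rintro _ ⟨n, hn, rfl⟩
        exact ⟨n, hd1 n t (hlarge n hn)⟩
      rw [hcoe, union_comm (insert x _), union_assoc]
      exact (isNontrivialConvergentSequence_of_tendsto
        (tendsto_def.mpr fun U hU => (hdy U hU).mono fun n hn => hn t) hinf).union_finite
        (hfin.union hE)
  · change ((A t ⊔ B t ⊔ F : NonemptyCompacts X) : Set X) ⊆ _
    rw [hcoe]
    refine union_subset (union_subset ?_ ?_) hE𝒱
    · refine insert_subset ⟨V, hV, hxV⟩ (range_subset_iff.mpr fun n => ⟨V, hV, ?_⟩)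
      obtain ⟨s, hs⟩ := hgr n t
      exact hs ▸ hγV n s
    · refine insert_subset ⟨W, hW, hyW⟩ (range_subset_iff.mpr fun n => ⟨W, hW, ?_⟩)
      obtain ⟨s, hs⟩ := hdr n t
      exact hs ▸ hδW n s
  · change (((A t ⊔ B t ⊔ F : NonemptyCompacts X) : Set X) ∩ V).Nonempty
    rw [hcoe]
    exact (hEhit V hV).mono (inter_subset_inter_left _ subset_union_right)

theorem joinedIn_convergentSequencesHitting [FirstCountableTopology X]
    [LocallyPathConnectedSpace X] (hfin : 𝒱.Finite)
    (h𝒱 : ∀ V ∈ 𝒱, IsOpen V ∧ IsPathConnected V) {K L : NonemptyCompacts X}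
    (hK : K ∈ convergentSequencesHitting 𝒱) (hL : L ∈ convergentSequencesHitting 𝒱) :
    JoinedIn (convergentSequencesHitting 𝒱) K L := by
  obtain ⟨hKc, hKi, x, hx, hKx⟩ := hK.1
  obtain ⟨hLc, hLi, y, hy, hLy⟩ := hL.1
  obtain ⟨V, hV, hxV⟩ := hK.2.1 hx
  obtain ⟨W, hW, hyW⟩ := hL.2.1 hy
  obtain ⟨u, hui, hu, huV, E, hE, hKE⟩ :=
    IsNontrivialConvergentSequence.exists_seq hKc hKi hx hKx (h𝒱 V hV).1 hxV
  obtain ⟨v, hvi, hv, hvW, E', hE', hLE'⟩ :=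
    IsNontrivialConvergentSequence.exists_seq hLc hLi hy hLy (h𝒱 W hW).1 hyW
  have : Nonempty X := ⟨x⟩
  choose! c hcK hcV using hK.2.2
  -- `D` absorbs both finite remainders, both limits, and a witness in each member of `𝒱`, so
  -- covering and hitting survive the motion of the tails.
  let D : Set X := E ∪ E' ∪ c '' 𝒱 ∪ {x, y}
  have hEK : E ⊆ K := hKE ▸ subset_union_right
  have hEL : E' ⊆ L := hLE' ▸ subset_union_right
  have hD : D.Finite := ((hE.union hE').union (hfin.image c)).union (by simp)
  have hD𝒱 : D ⊆ ⋃₀ 𝒱 := by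
    refine union_subset (union_subset (union_subset (hEK.trans hK.2.1) (hEL.trans hL.2.1)) ?_) ?_
    · rintro _ ⟨U, hU, rfl⟩
      exact ⟨U, hU, hcV U hU⟩
    · rintro _ (rfl | rfl)
      · exact ⟨V, hV, hxV⟩
      · exact ⟨W, hW, hyW⟩
  let M : NonemptyCompacts X :=
    ⟨⟨(K : Set X) ∪ D, K.isCompact.union hD.isCompact⟩, K.nonempty.mono subset_union_left⟩
  let N : NonemptyCompacts X :=
    ⟨⟨(L : Set X) ∪ D, L.isCompact.union hD.isCompact⟩, L.nonempty.mono subset_union_left⟩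
  have hKM := joinedIn_union_finite (fun V hV => (h𝒱 V hV).2) hK hD hD𝒱 M rfl
  have hLN := joinedIn_union_finite (fun V hV => (h𝒱 V hV).2) hL hD hD𝒱 N rfl
  refine (hKM.trans ?_).trans hLN.symm
  refine joinedIn_of_tendsto h𝒱 hV hW hu hv hui hvi huV hvW hxV hyW hD hD𝒱
    (fun U hU => ⟨c U, .inl (.inr ⟨U, hU, rfl⟩), hcV U hU⟩) (.inr (.inl rfl)) (.inr (.inr rfl)) ?_ ?_
  · change (K : Set X) ∪ D = _
    rw [hKE, union_assoc, union_eq_right.mpr (show E ⊆ D from fun z hz => .inl (.inl (.inl hz)))]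
  · change (L : Set X) ∪ D = _
    rw [hLE', union_assoc, union_eq_right.mpr (show E' ⊆ D from fun z hz => .inl (.inl (.inr hz)))]

theorem isPathConnected_nontrivialConvergentSequences [FirstCountableTopology X]
    [PathConnectedSpace X] [LocallyPathConnectedSpace X]
    (hne : (nontrivialConvergentSequences X).Nonempty) :
    IsPathConnected (nontrivialConvergentSequences X) := by
  have heq : convergentSequencesHitting {univ} = nontrivialConvergentSequences X := by
    ext K
    simp [convergentSequencesHitting, nontrivialConvergentSequences, K.nonempty]
  rw [isPathConnected_iff]
  refine ⟨hne, fun K hK L hL => ?_⟩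
  rw [← heq] at hK hL ⊢
  exact joinedIn_convergentSequencesHitting (finite_singleton _)
    (by rintro _ rfl; exact ⟨isOpen_univ, isPathConnected_univ⟩) hK hL

theorem locallyPathConnectedSpace_nontrivialConvergentSequences [FirstCountableTopology X]
    [LocallyPathConnectedSpace X] :
    LocallyPathConnectedSpace (nontrivialConvergentSequences X) := by
  have hB : IsTopologicalBasis {V : Set X | IsOpen V ∧ IsPathConnected V} := by
    refine isTopologicalBasis_of_isOpen_of_nhds (fun V hV => hV.1) fun x U hx hU => ?_
    obtain ⟨V, ⟨hV, hxV, hVc⟩, hVU⟩ :=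
      (isOpen_isPathConnected_basis x).mem_iff.mp (hU.mem_nhds hx)
    exact ⟨V, ⟨hV, hVc⟩, hxV, hVU⟩
  have hB' := hB.nonemptyCompacts
  rw [locallyPathConnectedSpace_iff_pathComponentIn_mem_nhds]
  rintro K O hO hKO
  obtain ⟨O', hO', rfl⟩ := isOpen_induced_iff.mp hO
  obtain ⟨_, ⟨𝒱, ⟨hfin, -, h𝒱⟩, rfl⟩, hK, hsub⟩ := hB'.exists_subset_of_mem_open hKO hO'
  have hKmem : (K : NonemptyCompacts X) ∈ convergentSequencesHitting 𝒱 := ⟨K.2, hK⟩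
  have hpc : IsPathConnected (convergentSequencesHitting 𝒱) := ⟨K, hKmem, fun L hL =>
    joinedIn_convergentSequencesHitting hfin (fun V hV => h𝒱 hV) hKmem hL⟩
  have hpc' := hpc.preimage_coe (U := nontrivialConvergentSequences X) fun L hL => hL.1
  refine mem_of_superset ?_ (hpc'.subset_pathComponentIn hKmem fun L hL => hsub hL.2)
  refine mem_of_superset (((hB'.isOpen ⟨𝒱, ⟨hfin, ?_, h𝒱⟩, rfl⟩).preimage
    continuous_subtype_val).mem_nhds hK) fun L hL => ⟨L.2, hL⟩
  obtain ⟨p, hp⟩ := (K : NonemptyCompacts X).nonempty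
  obtain ⟨V, hV, -⟩ := hK.1 hp
  exact ⟨V, hV⟩

end Hyperspace

theorem mainTheorem5 {X : Type*} [TopologicalSpace X] [T2Space X] [FirstCountableTopology X]
    (hne : (nontrivialConvergentSequences X).Nonempty) :
    (PathConnectedSpace X ∧ LocallyPathConnectedSpace X) ↔
      (PathConnectedSpace (nontrivialConvergentSequences X) ∧
        LocallyPathConnectedSpace (nontrivialConvergentSequences X)) := by
  constructor
  · rintro ⟨_, _⟩
    exact ⟨isPathConnected_iff_pathConnectedSpace.mp
      (isPathConnected_nontrivialConvergentSequences hne),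
      locallyPathConnectedSpace_nontrivialConvergentSequences⟩
  · rintro ⟨_, _⟩
    have := pathConnectedSpace_of_nontrivialConvergentSequences (X := X)
    obtain ⟨K, hK⟩ := hne
    have hnt : Nontrivial X := nontrivial_of_nontrivial hK.2.1.nontrivial
    exact ⟨this, locallyPathConnectedSpace_of_nontrivialConvergentSequences⟩
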